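/- Let $k$ be a nonperfect field of characteristic $2$ and let $K=\bar k$ be an algebraic closure of $k$. Let $G=PGL_2$ (with its standard $k$-structure), regarded through its group of $K$-points. Then $k$ contains a non-square, and for every $a\in k\setminus k^2$ the set $$H=\left\{\overline{\begin{pmatrix} x & ay\\ y & x\end{pmatrix}}\in PGL_2(K)\ :\ x,y\in K,\ x^2-ay^2\neq 0\right\}$$ of images in $PGL_2(K)$ of invertible matrices of this form is a closed, connected, unipotent subgroup of $G$ defined over $k$ such that: $H$ is $G$-irreducible over $k$ (it is contained in no proper parabolic subgroup of $G$ that is defined over $k$); hence $H$ is $G$-completely reducible over $k$ (whenever $H$ is contained in a parabolic subgroup $P$ of $G$ defined over $k$, it is contained in a Levi subgroup of $P$ defined over $k$); but $H$ is not pseudo-reductive, i.e. its $k$-unipotent radical $R_{u,k}(H)$ (the maximal connected unipotent normal subgroup of $H$ that is defined over $k$) is nontrivial. -/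

import Mathlib

open scoped MatrixGroups

/-!
Algebraic groups in the classical language.  `K` is an algebraically closed field containing `k`.
An affine algebraic group with a `k`-structure is given by its group `G` of `K`-points together
with the `k`-algebra `A = k[G]` of those regular functions `G → K` that are defined over `k`; the
algebra of all regular functions is `K[G] = K · k[G]`.  All notions below depend only on `(G, A)`.
-/

namespace AlgGrp

section General

variable {k K G : Type*} [Field k] [Field K] [Algebra k K] [Group G]

/-- The algebra `K[G]` of all regular functions, generated over `K` by `A = k[G]`. -/
def regular (A : Subalgebra k (G → K)) : Subalgebra K (G → K) :=
  Algebra.adjoin K (A : Set (G → K))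

/-- The Zariski topology on `G`: generated by the principal open sets of regular functions. -/
@[reducible]
def zariski (A : Subalgebra k (G → K)) : TopologicalSpace G :=
  TopologicalSpace.generateFrom {U | ∃ f ∈ regular A, U = {g | f g ≠ 0}}

/-- Zariski closed subsets. -/
def IsZClosed (A : Subalgebra k (G → K)) (Z : Set G) : Prop :=
  @IsClosed G (zariski A) Z

/-- Connected subsets in the Zariski topology. -/
def IsZConnected (A : Subalgebra k (G → K)) (Z : Set G) : Prop :=
  @IsConnected G (zariski A) Z

/-- A closed subset `Z` is defined over `k` if the ideal `I(Z)` of regular functions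
vanishing on `Z` is spanned over `K` by `I(Z) ∩ k[G]`. -/
def IsDefinedOver (A : Subalgebra k (G → K)) (Z : Set G) : Prop :=
  IsZClosed A Z ∧
    ∀ f ∈ regular A, (∀ z ∈ Z, f z = 0) →
      f ∈ Submodule.span K {h : G → K | h ∈ A ∧ ∀ z ∈ Z, h z = 0}

/-- Right translation of functions, `(ρ_g f)(x) = f (x g)`. -/
def rightTranslation (K : Type*) [Field K] (g : G) : Module.End K (G → K) :=
  LinearMap.funLeft K K (fun x : G => x * g)

/-- `g` is unipotent if right translation by `g` on `K[G]` is locally unipotent. -/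
def IsUnipotentElement (A : Subalgebra k (G → K)) (g : G) : Prop :=
  ∀ f ∈ regular A, ∃ n : ℕ, ((rightTranslation K g - 1) ^ n) f = 0

/-- A subgroup is unipotent if all its elements are unipotent. -/
def IsUnipotentSubgroup (A : Subalgebra k (G → K)) (H : Subgroup G) : Prop :=
  ∀ g ∈ H, IsUnipotentElement A g

/-- The `k`-unipotent radical `R_{u,k}(H)`: the maximal connected unipotent normal
`k`-subgroup of `H`, obtained as the subgroup generated by all such subgroups. -/
def kUnipotentRadical (A : Subalgebra k (G → K)) (H : Subgroup G) : Subgroup G :=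
  sSup {N : Subgroup G | N ≤ H ∧ (N.subgroupOf H).Normal ∧ IsDefinedOver A (N : Set G) ∧
    IsZConnected A (N : Set G) ∧ IsUnipotentSubgroup A N}

/-- The (geometric) unipotent radical `R_u(H)`, i.e. the unipotent radical over `K`. -/
def unipotentRadical (A : Subalgebra k (G → K)) (H : Subgroup G) : Subgroup G :=
  kUnipotentRadical (regular A) H

/-- A `k`-subgroup `H` is pseudo-reductive if it is connected and `R_{u,k}(H)` is trivial.
(Smoothness is automatic, since `H` is a variety.) -/
def IsPseudoReductive (A : Subalgebra k (G → K)) (H : Subgroup G) : Prop :=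
  IsDefinedOver A (H : Set G) ∧ IsZConnected A (H : Set G) ∧ kUnipotentRadical A H = ⊥

/-- Borel subgroups: maximal closed connected solvable subgroups of `G`. -/
def IsBorel (A : Subalgebra k (G → K)) (B : Subgroup G) : Prop :=
  Maximal (fun B : Subgroup G =>
    IsZClosed A (B : Set G) ∧ IsZConnected A (B : Set G) ∧ Group.IsSolvable B) B

/-- Parabolic subgroups: closed subgroups containing a Borel subgroup. -/
def IsParabolic (A : Subalgebra k (G → K)) (P : Subgroup G) : Prop :=
  IsZClosed A (P : Set G) ∧ ∃ B : Subgroup G, IsBorel A B ∧ B ≤ P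

/-- `k`-parabolic subgroups: parabolic subgroups defined over `k`. -/
def IsKParabolic (A : Subalgebra k (G → K)) (P : Subgroup G) : Prop :=
  IsParabolic A P ∧ IsDefinedOver A (P : Set G)

/-- Levi subgroups of `P`: closed subgroups `L` such that `P = L ⋉ R_u(P)` as algebraic groups.
The last condition says that the projection `P → L` is a morphism of varieties. -/
def IsLevi (A : Subalgebra k (G → K)) (P L : Subgroup G) : Prop :=
  IsZClosed A (L : Set G) ∧ L ⊓ unipotentRadical A P = ⊥ ∧ L ⊔ unipotentRadical A P = P ∧
    ∀ f ∈ regular A, ∃ f' ∈ regular A, ∀ l ∈ L, ∀ u ∈ unipotentRadical A P, f' (l * u) = f l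

/-- `k`-Levi subgroups of `P`: Levi subgroups of `P` defined over `k`. -/
def IsKLevi (A : Subalgebra k (G → K)) (P L : Subgroup G) : Prop :=
  IsLevi A P L ∧ IsDefinedOver A (L : Set G)

/-- `H` is `G`-completely reducible over `k`: whenever `H` is contained in a `k`-parabolic
subgroup `P` of `G`, it is contained in some `k`-Levi subgroup of `P`. -/
def IsCompletelyReducibleOver (A : Subalgebra k (G → K)) (H : Subgroup G) : Prop :=
  ∀ P : Subgroup G, IsKParabolic A P → H ≤ P → ∃ L : Subgroup G, IsKLevi A P L ∧ H ≤ L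

/-- `H` is `G`-irreducible over `k`: it is contained in no proper `k`-parabolic subgroup. -/
def IsIrreducibleOver (A : Subalgebra k (G → K)) (H : Subgroup G) : Prop :=
  ∀ P : Subgroup G, IsKParabolic A P → H ≤ P → P = ⊤

end General

section PGL

variable (k K : Type*) [Field k] [Field K] [Algebra k K] (n : ℕ)

/-- `k[GL_n] = k[x_ij, 1/det]`, as an algebra of functions on `GL_n(K)`. -/
def coordGL : Subalgebra k (GL (Fin n) K → K) :=
  Algebra.adjoin k
    ({f | ∃ i j : Fin n, f = fun g : GL (Fin n) K => (g : Matrix (Fin n) (Fin n) K) i j} ∪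
      {fun g : GL (Fin n) K => ((g : Matrix (Fin n) (Fin n) K).det)⁻¹})

/-- Pullback of functions along `GL_n(K) → PGL_n(K)`. -/
def pullback : (PGL(n, K) → K) →ₐ[k] (GL (Fin n) K → K) :=
  AlgHom.pi fun g =>
    Pi.evalAlgHom k (fun _ => K) (Matrix.ProjGenLinGroup.mk g)

/-- `k[PGL_n] = k[GL_n]^{G_m}`: the functions on `PGL_n(K)` whose pullback to `GL_n(K)`
lies in `k[GL_n]`. -/
def coordPGL : Subalgebra k (PGL(n, K) → K) :=
  (coordGL k K n).comap (pullback k K n)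

end PGL

end AlgGrp

/-!
A solvable Zariski-connected subgroup `S` of `PGL₂(K)` fixes a point of `ℙ¹(K)`: an element `d ≠ 1`
of the last nontrivial term of its derived series commutes with all its conjugates under `S`.
In characteristic `2` commuting classes are represented by commuting matrices, so `d` fixes all
points of the `S`-orbit of any of its fixed points, and an orbit which is finite and connected is a
single point. Hence the Borel subgroups are the stabilizers of points; since these are maximal
subgroups, they are also the only proper parabolic subgroups. The same argument, applied to
`S = PGL₂(K)` and to an element `d ≠ 1` of a normal unipotent subgroup (which is commutative, as
its elements are involutions), would give a point fixed by `PGL₂(K)`; so `R_u(PGL₂) = 1`.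

The group `H` of the theorem is connected, unipotent and defined over `k`, being the section of
`PGL₂ ⊆ ℙ(M₂)` by a linear subspace spanned by `k`-rational matrices; so it is its own
`k`-unipotent radical. The only point it fixes is `[√a : 1]`, whose stabilizer is not defined over
`k`, as `√a ∉ k`. Thus the only `k`-parabolic subgroup containing `H` is `PGL₂` itself, which is
its own Levi subgroup.
-/

namespace AlgGrp

open Matrix.ProjGenLinGroup (mk mk_surjective mk_eq_mk_iff)
open scoped LinearAlgebra.Projectivization

section ZariskiTopology

variable {k K G : Type*} [Field k] [Field K] [Algebra k K] {A : Subalgebra k (G → K)}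

theorem isZClosed_zeroLocus {F : Set (G → K)} (hF : F ⊆ regular A) :
    IsZClosed A {g | ∀ f ∈ F, f g = 0} := by
  let := zariski A
  have h : {g | ∀ f ∈ F, f g = 0} = ⋂ f ∈ F, {g : G | f g ≠ 0}ᶜ := by ext; simp
  rw [IsZClosed, h]
  exact isClosed_biInter fun f hf =>
    isClosed_compl_iff.mpr (TopologicalSpace.isOpen_generateFrom_of_mem ⟨f, hF hf, rfl⟩)

theorem isZClosed_univ : IsZClosed A (Set.univ : Set G) :=
  @isClosed_univ G (zariski A)

theorem isTopologicalBasis_zariski (A : Subalgebra k (G → K)) :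
    @TopologicalSpace.IsTopologicalBasis G (zariski A)
      {U | ∃ f ∈ regular A, U = {g | f g ≠ 0}} := by
  let := zariski A
  refine ⟨?_, ?_, rfl⟩
  · rintro _ ⟨f, hf, rfl⟩ _ ⟨f', hf', rfl⟩ x ⟨hx, hx'⟩
    exact ⟨_, ⟨f * f', mul_mem hf hf', rfl⟩, mul_ne_zero hx hx',
      fun y hy => ⟨left_ne_zero_of_mul hy, right_ne_zero_of_mul hy⟩⟩
  · exact Set.eq_univ_of_forall fun x => ⟨_, ⟨1, one_mem _, rfl⟩, by simp⟩

theorem isZConnected_of_forall_ne_zero {Z : Set G} (hne : Z.Nonempty)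
    (h : ∀ f ∈ regular A, ∀ f' ∈ regular A, (∃ z ∈ Z, f z ≠ 0) → (∃ z ∈ Z, f' z ≠ 0) →
      ∃ z ∈ Z, f z ≠ 0 ∧ f' z ≠ 0) : IsZConnected A Z := by
  let := zariski A
  refine ⟨hne, IsPreirreducible.isPreconnected ?_⟩
  rintro U V hU hV ⟨x, hxZ, hxU⟩ ⟨y, hyZ, hyV⟩
  obtain ⟨_, ⟨f, hf, rfl⟩, hx, hfU⟩ :=
    (isTopologicalBasis_zariski A).exists_subset_of_mem_open hxU hU
  obtain ⟨_, ⟨f', hf', rfl⟩, hy, hfV⟩ :=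
    (isTopologicalBasis_zariski A).exists_subset_of_mem_open hyV hV
  obtain ⟨z, hz, hfz, hfz'⟩ := h f hf f' hf' ⟨x, hxZ, hx⟩ ⟨y, hyZ, hy⟩
  exact ⟨z, hz, hfU hfz, hfV hfz'⟩

theorem IsZConnected.subset_of_finite_cover {ι : Type*} {S : Set G} (hS : IsZConnected A S)
    {I : Set ι} (hI : I.Finite) {Z : ι → Set G} (hZ : ∀ i, IsZClosed A (Z i))
    (hdisj : Pairwise (Function.onFun Disjoint Z)) (hcov : S ⊆ ⋃ i ∈ I, Z i) {i : ι}
    (hi : (S ∩ Z i).Nonempty) : S ⊆ Z i := by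
  let := zariski A
  let W := ⋃ j ∈ I \ {i}, Z j
  have hW : IsClosed W := hI.sdiff.isClosed_biUnion fun j _ => hZ j
  have hcov' : S ⊆ Z i ∪ W := fun s hs => by
    obtain ⟨j, hj, hsj⟩ := Set.mem_iUnion₂.mp (hcov hs)
    rcases eq_or_ne j i with rfl | hji
    · exact Or.inl hsj
    · exact Or.inr (Set.mem_biUnion (⟨hj, hji⟩ : j ∈ I \ {i}) hsj)
  have hdisjW : Disjoint (Z i) W :=
    Set.disjoint_iUnion₂_right.mpr fun j hj => hdisj (Ne.symm hj.2)
  refine ((isPreconnected_iff_subset_of_disjoint_closed.mp hS.isPreconnected) _ _ (hZ i) hW hcov'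
    (by rw [hdisjW.inter_eq, Set.inter_empty])).resolve_right fun hSW => ?_
  obtain ⟨s, hs, hsi⟩ := hi
  exact Set.disjoint_left.mp hdisjW hsi (hSW hs)

end ZariskiTopology

section FieldOfDefinition

variable {k K G : Type*} [Field k] [Field K] [Algebra k K] {A : Subalgebra k (G → K)}

theorem mem_regular_of_mem {f : G → K} (hf : f ∈ A) : f ∈ regular A :=
  Algebra.subset_adjoin hf

theorem regular_eq_span (A : Subalgebra k (G → K)) :
    Subalgebra.toSubmodule (regular A) = Submodule.span K (A : Set (G → K)) := by
  have h : Submonoid.closure (A : Set (G → K)) = A.toSubmonoid :=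
    Submonoid.closure_eq A.toSubmonoid
  rw [regular, Algebra.adjoin_eq_span, h]
  rfl

theorem regular_regular (A : Subalgebra k (G → K)) : regular (regular A) = regular A :=
  Algebra.adjoin_eq _

theorem isDefinedOver_univ : IsDefinedOver A (Set.univ : Set G) := by
  refine ⟨isZClosed_univ, fun f _ hf => ?_⟩
  rw [show f = 0 from funext fun g => hf g (Set.mem_univ g)]
  exact zero_mem _

theorem exists_eq_sum_basis_smul_of_mem_span {V ι : Type*} [AddCommGroup V] [Module k V]
    [Module K V] [IsScalarTower k K V] (b : Module.Basis ι k K) (A : Submodule k V) {v : V}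
    (hv : v ∈ Submodule.span K (A : Set V)) :
    ∃ a : ι →₀ A, v = a.sum fun i x => b i • (x : V) := by
  let Φ : (ι →₀ A) →ₗ[k] V := Finsupp.lsum k fun i =>
    ((LinearMap.lsmul K V (b i)).restrictScalars k) ∘ₗ A.subtype
  suffices hv : v ∈ LinearMap.range Φ by
    obtain ⟨a, rfl⟩ := hv
    exact ⟨a, rfl⟩
  induction hv using Submodule.closure_induction with
  | zero => exact zero_mem _
  | add v w _ _ hv hw => exact add_mem hv hw
  | smul_mem c a ha =>
    have hc : c • a = (b.repr c).sum fun i t => t • (b i • a) := by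
      conv_lhs => rw [← b.linearCombination_repr c, Finsupp.linearCombination_apply]
      simp only [Finsupp.sum, Finset.sum_smul, smul_assoc]
    rw [hc]
    refine Submodule.sum_mem _ fun i _ => Submodule.smul_mem _ _ ⟨Finsupp.single i ⟨a, ha⟩, ?_⟩
    exact Finsupp.sum_single_index (smul_zero _)

-- Expand a regular function in a basis of `K` over `k`: at a `k`-rational point it vanishes only
-- if all its coordinates do.
theorem isDefinedOver_of_dense_rational {Z D : Set G} (hZ : IsZClosed A Z) (hDZ : D ⊆ Z)
    (hrat : ∀ h ∈ A, ∀ x ∈ D, h x ∈ (algebraMap k K).range)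
    (hdense : ∀ h ∈ A, (∀ x ∈ D, h x = 0) → ∀ z ∈ Z, h z = 0) : IsDefinedOver A Z := by
  refine ⟨hZ, fun f hf hfZ => ?_⟩
  let b := Module.Basis.ofVectorSpace k K
  have hspan : f ∈ Submodule.span K (Subalgebra.toSubmodule A : Set (G → K)) := by
    rwa [← Subalgebra.mem_toSubmodule, regular_eq_span] at hf
  obtain ⟨a, rfl⟩ := exists_eq_sum_basis_smul_of_mem_span b _ hspan
  refine Submodule.sum_mem _ fun i hi => Submodule.smul_mem _ _ (Submodule.subset_span
    ⟨(a i).2, hdense _ (a i).2 fun x hx => ?_⟩)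
  choose c hc using fun j => hrat _ (a j).2 x hx
  have hsum : ∑ j ∈ a.support, c j • b j = 0 := by
    rw [← hfZ x (hDZ hx), Finsupp.sum, Finset.sum_apply]
    refine Finset.sum_congr rfl fun j _ => ?_
    rw [Pi.smul_apply, smul_eq_mul, ← hc, Algebra.smul_def, mul_comm]
  rw [← hc, linearIndependent_iff'.mp b.linearIndependent _ _ hsum i hi, map_zero]

end FieldOfDefinition

section Unipotent

variable {k K G : Type*} [Field k] [Field K] [Algebra k K] [Group G] {A : Subalgebra k (G → K)}

theorem rightTranslation_pow (g : G) (n : ℕ) :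
    rightTranslation K g ^ n = rightTranslation K (g ^ n) := by
  induction n with
  | zero => ext; simp [rightTranslation, LinearMap.funLeft_apply]
  | succ n ih =>
    rw [pow_succ, pow_succ, ih]
    ext f x
    exact congrArg f (mul_assoc x (g ^ n) g)

theorem rightTranslation_sub_one_pow_char_pow (p : ℕ) [Fact p.Prime] [CharP K p] (g : G) (m : ℕ) :
    (rightTranslation K g - 1) ^ p ^ m = rightTranslation K (g ^ p ^ m) - 1 := by
  have : CharP (Module.End K (G → K)) p :=
    charP_of_injective_algebraMap (algebraMap K (Module.End K (G → K))).injective p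
  rw [sub_pow_char_pow_of_commute p m (Commute.one_right _), one_pow, rightTranslation_pow]

theorem isUnipotentElement_of_pow_char_pow_eq_one (p : ℕ) [Fact p.Prime] [CharP K p] {g : G}
    {m : ℕ} (hg : g ^ p ^ m = 1) : IsUnipotentElement A g := by
  refine fun f _ => ⟨p ^ m, ?_⟩
  rw [rightTranslation_sub_one_pow_char_pow p, hg]
  ext x
  simp [rightTranslation, LinearMap.funLeft_apply]

theorem IsUnipotentElement.exists_pow_char_pow (p : ℕ) [Fact p.Prime] [CharP K p] {g : G}
    (hg : IsUnipotentElement A g) {ι : Type*} [Finite ι] {f : ι → G → K}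
    (hf : ∀ i, f i ∈ regular A) : ∃ m : ℕ, ∀ i x, f i (x * g ^ p ^ m) = f i x := by
  cases nonempty_fintype ι
  choose n hn using fun i => hg (f i) (hf i)
  refine ⟨∑ i, n i, fun i x => ?_⟩
  have hle : n i ≤ p ^ ∑ i, n i :=
    (Finset.single_le_sum (fun _ _ => Nat.zero_le _) (Finset.mem_univ i)).trans
      (Nat.lt_pow_self (Fact.out : p.Prime).one_lt).le
  have hzero : ((rightTranslation K g - 1) ^ p ^ ∑ i, n i) (f i) = 0 := by
    rw [← Nat.sub_add_cancel hle, pow_add, Module.End.mul_apply, hn, map_zero]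
  rw [rightTranslation_sub_one_pow_char_pow p] at hzero
  exact sub_eq_zero.mp (congrFun hzero x)

theorem isUnipotentSubgroup_regular {N : Subgroup G} :
    IsUnipotentSubgroup (regular A) N ↔ IsUnipotentSubgroup A N := by
  simp only [IsUnipotentSubgroup, IsUnipotentElement, regular_regular]

end Unipotent

section Radical

variable {k K G : Type*} [Field k] [Field K] [Algebra k K] [Group G] {A : Subalgebra k (G → K)}
  {H : Subgroup G}

theorem kUnipotentRadical_eq_self (hdef : IsDefinedOver A (H : Set G))
    (hconn : IsZConnected A (H : Set G)) (hun : IsUnipotentSubgroup A H) :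
    kUnipotentRadical A H = H :=
  le_antisymm (sSup_le fun _ hN => hN.1)
    (le_sSup ⟨le_rfl, by rw [Subgroup.subgroupOf_self]; infer_instance, hdef, hconn, hun⟩)

theorem not_isPseudoReductive_of_isUnipotentSubgroup (hH : H ≠ ⊥)
    (hun : IsUnipotentSubgroup A H) : ¬ IsPseudoReductive A H :=
  fun ⟨hdef, hconn, hbot⟩ => hH (kUnipotentRadical_eq_self hdef hconn hun ▸ hbot)

theorem isKLevi_top (h : unipotentRadical A (⊤ : Subgroup G) = ⊥) :
    IsKLevi A (⊤ : Subgroup G) ⊤ := by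
  refine ⟨⟨isZClosed_univ, by simp [h], by simp, fun f hf => ⟨f, hf, fun l _ u hu => ?_⟩⟩,
    isDefinedOver_univ⟩
  rw [h, Subgroup.mem_bot] at hu
  rw [hu, mul_one]

theorem IsIrreducibleOver.isCompletelyReducibleOver (hH : IsIrreducibleOver A H)
    (h : unipotentRadical A (⊤ : Subgroup G) = ⊥) : IsCompletelyReducibleOver A H := by
  intro P hP hle
  obtain rfl := hH P hP hle
  exact ⟨⊤, isKLevi_top h, le_top⟩

end Radical

theorem exists_ne_one_forall_commute_conj (S : Type*) [Group S] [Nontrivial S]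
    [Group.IsSolvable S] : ∃ d : S, d ≠ 1 ∧ ∀ s, Commute (s⁻¹ * d * s) d := by
  classical
  have hex : ∃ n, derivedSeries S n = ⊥ := Group.IsSolvable.solvable
  obtain ⟨m, hm⟩ : ∃ m, Nat.find hex = m + 1 := Nat.exists_eq_succ_of_ne_zero fun h0 =>
    top_ne_bot (α := Subgroup S) (by simpa [h0] using Nat.find_spec hex)
  have hbot : derivedSeries S (m + 1) = ⊥ := hm ▸ Nat.find_spec hex
  obtain ⟨⟨d, hd⟩, hd1⟩ :=
    Subgroup.ne_bot_iff_exists_ne_one.mp (Nat.find_min hex (m := m) (by omega))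
  refine ⟨d, fun h => hd1 (Subtype.ext h), fun s => ?_⟩
  have hconj : s⁻¹ * d * s ∈ derivedSeries S m := by
    simpa using (derivedSeries_normal S m).conj_mem d hd s⁻¹
  have hcomm := Subgroup.commutator_mem_commutator hconj hd
  rwa [← derivedSeries_succ, hbot, Subgroup.mem_bot, commutatorElement_eq_one_iff_mul_comm] at hcomm

section RegularFunctions

variable {k K : Type*} [Field k] [Field K] [Algebra k K] {n : ℕ}

theorem mk_eq_mk_iff_exists_smul {M N : GL (Fin n) K} :
    mk M = mk N ↔ ∃ c : K, c ≠ 0 ∧ N.val = c • M.val := by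
  rw [mk_eq_mk_iff]
  constructor
  · rintro ⟨u, rfl⟩
    refine ⟨u, u.ne_zero, ?_⟩
    ext i j
    simp [mul_comm]
  · rintro ⟨c, hc, h⟩
    refine ⟨Units.mk0 c hc, ?_⟩
    ext i j
    simp [h, mul_comm]

theorem mk_eq_one_of_val_eq_smul_one {M : GL (Fin n) K} {c : K} (h : M.val = c • 1) :
    mk M = 1 := by
  rw [Matrix.ProjGenLinGroup.mk_eq_one, Subgroup.mem_center_iff]
  intro g
  ext1
  simp [h]

theorem exists_eval_eq_of_mem_coordGL {R : Type*} [CommRing R] [Algebra k R]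
    (φ : Matrix (Fin n) (Fin n) R) {f : GL (Fin n) K → K} (hf : f ∈ coordGL k K n) :
    ∃ (N : ℕ) (r : R), ∀ (e : R →ₐ[k] K) (g : GL (Fin n) K),
      g.val = φ.map e → f g * g.val.det ^ N = e r := by
  have hdet (e : R →ₐ[k] K) (g : GL (Fin n) K) (h : g.val = φ.map e) : g.val.det = e φ.det :=
    h ▸ (AlgHom.map_det e φ).symm
  induction hf using Algebra.adjoin_induction with
  | mem f hf =>
    rcases hf with ⟨i, j, rfl⟩ | rfl
    · exact ⟨0, φ i j, fun e g h => by simp [h]⟩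
    · exact ⟨1, 1, fun e g _ => by simp [inv_mul_cancel₀ g.det_ne_zero]⟩
  | algebraMap c => exact ⟨0, algebraMap k R c, fun e g _ => by simp⟩
  | add f f' _ _ h h' =>
    obtain ⟨N, r, hr⟩ := h
    obtain ⟨N', r', hr'⟩ := h'
    refine ⟨N + N', r * φ.det ^ N' + r' * φ.det ^ N, fun e g h => ?_⟩
    simp only [map_add, map_mul, map_pow, ← hr e g h, ← hr' e g h, ← hdet e g h, Pi.add_apply]
    ring
  | mul f f' _ _ h h' =>
    obtain ⟨N, r, hr⟩ := h
    obtain ⟨N', r', hr'⟩ := h'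
    refine ⟨N + N', r * r', fun e g h => ?_⟩
    simp only [map_mul, ← hr e g h, ← hr' e g h, Pi.mul_apply]
    ring

theorem exists_eval_eq_of_mem_coordPGL {R : Type*} [CommRing R] [Algebra k R]
    (φ : Matrix (Fin n) (Fin n) R) {f : PGL(n, K) → K} (hf : f ∈ coordPGL k K n) :
    ∃ (N : ℕ) (r : R), ∀ (e : R →ₐ[k] K) (g : GL (Fin n) K),
      g.val = φ.map e → f (mk g) * g.val.det ^ N = e r :=
  exists_eval_eq_of_mem_coordGL φ (f := pullback k K n f) hf

theorem regular_coordPGL_le : regular (coordPGL k K n) ≤ coordPGL K K n := by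
  have hGL : coordGL k K n ≤ (coordGL K K n).restrictScalars k :=
    Algebra.adjoin_le Algebra.subset_adjoin
  exact Algebra.adjoin_le fun f hf => hGL (show pullback k K n f ∈ coordGL k K n from hf)

theorem exists_mem_coordPGL_apply_mk {F : GL (Fin n) K → K} (hF : F ∈ coordGL k K n)
    (hinv : ∀ M N, mk M = mk N → F M = F N) :
    ∃ f ∈ coordPGL k K n, ∀ M, f (mk M) = F M := by
  have hf (M : GL (Fin n) K) : F (Function.surjInv mk_surjective (mk M)) = F M :=
    hinv _ _ (Function.surjInv_eq mk_surjective _)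
  refine ⟨F ∘ Function.surjInv mk_surjective, ?_, hf⟩
  have hpull : pullback k K n (F ∘ Function.surjInv mk_surjective) = F := funext hf
  rwa [coordPGL, Subalgebra.mem_comap, hpull]

variable (k) in
theorem exists_mem_coordPGL_entry_mul_pow (a b i j : Fin n) :
    ∃ f ∈ coordPGL k K n, ∀ M : GL (Fin n) K,
      f (mk M) = M.val a b * M.val i j ^ (n - 1) * M.val.det⁻¹ := by
  have hentry (a b : Fin n) : (fun M : GL (Fin n) K => M.val a b) ∈ coordGL k K n :=
    Algebra.subset_adjoin (Or.inl ⟨a, b, rfl⟩)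
  refine exists_mem_coordPGL_apply_mk (mul_mem (mul_mem (hentry a b) (pow_mem (hentry i j) (n - 1)))
    (Algebra.subset_adjoin (Or.inr rfl))) fun M N h => ?_
  obtain ⟨c, hc, hN⟩ := mk_eq_mk_iff_exists_smul.mp h
  have hpow : c * c ^ (n - 1) = c ^ n := mul_pow_sub_one (Fin.pos a).ne' c
  have hdet := M.det_ne_zero
  simp only [hN, Matrix.smul_apply, smul_eq_mul, mul_pow, Matrix.det_smul, Fintype.card_fin,
    ← hpow]
  field_simp

theorem exists_mem_regular_linear_mul_pow (ℓ : Matrix (Fin n) (Fin n) K →ₗ[K] K) (i j : Fin n) :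
    ∃ f ∈ regular (coordPGL k K n), ∀ M : GL (Fin n) K,
      f (mk M) = ℓ M.val * M.val i j ^ (n - 1) * M.val.det⁻¹ := by
  choose f hf hfM using fun a b => exists_mem_coordPGL_entry_mul_pow k (K := K) a b i j
  refine ⟨∑ a, ∑ b, ℓ (Matrix.single a b 1) • f a b, sum_mem fun a _ => sum_mem fun b _ =>
    Subalgebra.smul_mem _ (mem_regular_of_mem (hf a b)) _, fun M => ?_⟩
  have hℓ : ℓ M.val = ∑ a, ∑ b, M.val a b * ℓ (Matrix.single a b 1) := by
    conv_lhs => rw [Matrix.matrix_eq_sum_single M.val]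
    simp only [map_sum, ← smul_eq_mul, ← map_smul, Matrix.smul_single]
    simp only [smul_eq_mul, mul_one]
  simp only [Finset.sum_apply, Pi.smul_apply, smul_eq_mul, hfM, hℓ, Finset.sum_mul]
  exact Finset.sum_congr rfl fun a _ => Finset.sum_congr rfl fun b _ => by ring

variable (k K n) in
theorem exists_coordPGL_separating_one :
    ∃ f : Fin n × Fin n × Fin n → PGL(n, K) → K, (∀ i, f i ∈ coordPGL k K n) ∧
      ∀ g, (∀ i, f i g = f i 1) → g = 1 := by
  choose f hf hfM using fun t : Fin n × Fin n × Fin n =>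
    exists_mem_coordPGL_entry_mul_pow k (K := K) t.1 t.2.1 t.2.2 t.2.2
  refine ⟨f, hf, fun g hg => ?_⟩
  obtain ⟨M, rfl⟩ := mk_surjective g
  have hM (a b i : Fin n) : M.val a b * M.val i i ^ (n - 1) * M.val.det⁻¹ =
      (1 : Matrix (Fin n) (Fin n) K) a b := by
    have h := hg (a, b, i)
    rw [← map_one mk, hfM, hfM] at h
    simpa using h
  have hpow (i : Fin n) : M.val i i ^ (n - 1) * M.val.det⁻¹ ≠ 0 := fun h => by
    simpa [mul_assoc, h] using hM i i i
  have hdiag (a b : Fin n) : M.val a a = M.val b b := by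
    refine mul_right_cancel₀ (hpow a) ?_
    rw [← mul_assoc, ← mul_assoc, hM, hM, Matrix.one_apply_eq, Matrix.one_apply_eq]
  rcases isEmpty_or_nonempty (Fin n) with _ | ⟨⟨i⟩⟩
  · exact mk_eq_one_of_val_eq_smul_one (c := 0) (Subsingleton.elim _ _)
  · refine mk_eq_one_of_val_eq_smul_one (c := M.val i i) ?_
    ext a b
    rcases eq_or_ne a b with rfl | hab
    · simp [hdiag a i]
    · have h := hM a b a
      rw [mul_assoc, Matrix.one_apply_ne hab] at h
      simpa [hab] using (mul_eq_zero.mp h).resolve_right (hpow a)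

theorem IsUnipotentElement.exists_pow_char_pow_eq_one (p : ℕ) [Fact p.Prime] [CharP K p]
    {g : PGL(n, K)} (hg : IsUnipotentElement (coordPGL k K n) g) : ∃ m : ℕ, g ^ p ^ m = 1 := by
  obtain ⟨f, hf, hsep⟩ := exists_coordPGL_separating_one k K n
  obtain ⟨m, hm⟩ := hg.exists_pow_char_pow p fun i => mem_regular_of_mem (hf i)
  exact ⟨m, hsep _ fun i => by simpa using hm i 1⟩

end RegularFunctions

section LinearSection

variable {k K : Type*} [Field k] [Field K] [Algebra k K] {n : ℕ}

/-- The image in `PGL_n(K)` of the invertible matrices lying in a linear subspace `V` of `M_n(K)`,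
i.e. the section of `PGL_n ⊆ ℙ(M_n)` by the projective subspace `ℙ(V)`. -/
def linearSection (V : Submodule K (Matrix (Fin n) (Fin n) K)) : Set PGL(n, K) :=
  mk '' {M | M.val ∈ V}

theorem mk_mem_linearSection {V : Submodule K (Matrix (Fin n) (Fin n) K)} {M : GL (Fin n) K} :
    mk M ∈ linearSection V ↔ M.val ∈ V := by
  refine ⟨?_, fun h => ⟨M, h, rfl⟩⟩
  rintro ⟨N, hN, h⟩
  obtain ⟨c, -, hc⟩ := mk_eq_mk_iff_exists_smul.mp h
  exact hc ▸ V.smul_mem c hN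

theorem linearSection_top :
    linearSection (⊤ : Submodule K (Matrix (Fin n) (Fin n) K)) = Set.univ := by
  simp [linearSection, mk_surjective.range_eq]

theorem isZClosed_linearSection (V : Submodule K (Matrix (Fin n) (Fin n) K)) :
    IsZClosed (coordPGL k K n) (linearSection V) := by
  let F := {f | f ∈ regular (coordPGL k K n) ∧ ∀ z ∈ linearSection V, f z = 0}
  suffices h : linearSection V = {g | ∀ f ∈ F, f g = 0} from
    h ▸ isZClosed_zeroLocus fun f hf => hf.1
  refine Set.Subset.antisymm (fun z hz f hf => hf.2 z hz) fun z hz => ?_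
  obtain ⟨M, rfl⟩ := mk_surjective z
  rw [mk_mem_linearSection]
  by_contra hM
  obtain ⟨ℓ, hℓM, hℓV⟩ := Submodule.exists_dual_map_eq_bot_of_notMem hM inferInstance
  obtain ⟨i, j, hij⟩ : ∃ i j, M.val i j ≠ 0 := by
    by_contra! h
    exact hM ((show M.val = 0 from Matrix.ext h) ▸ V.zero_mem)
  obtain ⟨f, hf, hfM⟩ := exists_mem_regular_linear_mul_pow (k := k) ℓ i j
  refine mul_ne_zero (mul_ne_zero hℓM (pow_ne_zero _ hij)) (inv_ne_zero M.det_ne_zero)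
    ((hfM M).symm.trans (hz f ⟨hf, ?_⟩))
  rintro _ ⟨N, hN, rfl⟩
  have hℓN : ℓ N.val = 0 := (Submodule.mem_bot K).mp (hℓV ▸ Submodule.mem_map_of_mem hN)
  rw [hfM, hℓN, zero_mul, zero_mul]

-- A product of nonzero polynomials in the coefficients does not vanish identically on an infinite
-- grid.
theorem exists_coeff_mem_apply_ne_zero {ι : Type*} [Fintype ι] (b : ι → Matrix (Fin n) (Fin n) K)
    {S : Set K} (hS : S.Infinite) {f f' : PGL(n, K) → K} (hf : f ∈ regular (coordPGL k K n))
    (hf' : f' ∈ regular (coordPGL k K n))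
    (hne : ∃ z ∈ linearSection (Submodule.span K (Set.range b)), f z ≠ 0)
    (hne' : ∃ z ∈ linearSection (Submodule.span K (Set.range b)), f' z ≠ 0) :
    ∃ (s : ι → K) (M : GL (Fin n) K), (∀ i, s i ∈ S) ∧ M.val = ∑ i, s i • b i ∧
      f (mk M) ≠ 0 ∧ f' (mk M) ≠ 0 := by
  let φ : Matrix (Fin n) (Fin n) (MvPolynomial ι K) :=
    ∑ i, (MvPolynomial.X i : MvPolynomial ι K) • (b i).map MvPolynomial.C
  have hφ (s : ι → K) : φ.map (MvPolynomial.aeval s) = ∑ i, s i • b i := by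
    ext a b
    simp [φ, Matrix.sum_apply]
  have hdet (s : ι → K) : MvPolynomial.aeval s φ.det = (∑ i, s i • b i).det := by
    rw [AlgHom.map_det, ← hφ]
    rfl
  obtain ⟨N, r, hr⟩ := exists_eval_eq_of_mem_coordPGL φ (regular_coordPGL_le hf)
  obtain ⟨N', r', hr'⟩ := exists_eval_eq_of_mem_coordPGL φ (regular_coordPGL_le hf')
  obtain ⟨_, ⟨M, hM, rfl⟩, hfM⟩ := hne
  obtain ⟨_, ⟨M', hM', rfl⟩, hfM'⟩ := hne'
  obtain ⟨c, hc⟩ := (Submodule.mem_span_range_iff_exists_fun K).mp hM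
  obtain ⟨c', hc'⟩ := (Submodule.mem_span_range_iff_exists_fun K).mp hM'
  have hr0 : r ≠ 0 := by
    rintro rfl
    exact mul_ne_zero hfM (pow_ne_zero N M.det_ne_zero)
      ((hr (MvPolynomial.aeval c) M (by rw [hφ, hc])).trans (map_zero _))
  have hr0' : r' ≠ 0 := by
    rintro rfl
    exact mul_ne_zero hfM' (pow_ne_zero N' M'.det_ne_zero)
      ((hr' (MvPolynomial.aeval c') M' (by rw [hφ, hc'])).trans (map_zero _))
  have hdet0 : φ.det ≠ 0 := fun h => M.det_ne_zero (by rw [← hc, ← hdet, h, map_zero])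
  obtain ⟨s, hs, hsne⟩ : ∃ s ∈ Set.pi Set.univ fun _ => S,
      MvPolynomial.aeval s (r * r' * φ.det) ≠ 0 := by
    by_contra! h
    exact mul_ne_zero (mul_ne_zero hr0 hr0') hdet0
      (MvPolynomial.funext_set _ (fun _ => hS) fun s hs => by simpa using h s hs)
  simp only [map_mul, hdet, mul_ne_zero_iff] at hsne
  let P : GL (Fin n) K := Matrix.GeneralLinearGroup.mkOfDetNeZero _ hsne.2
  refine ⟨s, P, fun i => hs i trivial, rfl, fun h => hsne.1.1 ?_, fun h => hsne.1.2 ?_⟩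
  · rw [← hr _ P (hφ s).symm, h, zero_mul]
  · rw [← hr' _ P (hφ s).symm, h, zero_mul]

theorem isZConnected_linearSection [Infinite K] {V : Submodule K (Matrix (Fin n) (Fin n) K)}
    (hV : (linearSection V).Nonempty) : IsZConnected (coordPGL k K n) (linearSection V) := by
  obtain ⟨m, b, rfl⟩ :=
    Submodule.fg_iff_exists_fin_generating_family.mp (IsNoetherian.noetherian V)
  refine isZConnected_of_forall_ne_zero hV fun f hf f' hf' hne hne' => ?_
  obtain ⟨s, M, -, hM, hfM, hfM'⟩ :=
    exists_coeff_mem_apply_ne_zero b Set.infinite_univ hf hf' hne hne'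
  exact ⟨mk M, ⟨M, (Submodule.mem_span_range_iff_exists_fun K).mpr ⟨s, hM.symm⟩, rfl⟩, hfM, hfM'⟩

theorem apply_mk_mem_range_of_val_eq_map {h : PGL(n, K) → K} (hh : h ∈ coordPGL k K n)
    {M : GL (Fin n) K} {M₀ : Matrix (Fin n) (Fin n) k} (hM : M.val = M₀.map (algebraMap k K)) :
    h (mk M) ∈ (algebraMap k K).range := by
  obtain ⟨N, r, hr⟩ := exists_eval_eq_of_mem_coordPGL (K := K) M₀ hh
  have hdet : M.val.det = algebraMap k K M₀.det := by rw [hM, RingHom.map_det]; rfl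
  rw [eq_div_of_mul_eq (pow_ne_zero N M.det_ne_zero) (hr (Algebra.ofId k K) M hM), hdet]
  exact ⟨r / M₀.det ^ N, by rw [map_div₀, map_pow]; rfl⟩

theorem isDefinedOver_linearSection [Infinite k] {ι : Type*} [Finite ι]
    (b : ι → Matrix (Fin n) (Fin n) k) :
    IsDefinedOver (coordPGL k K n)
      (linearSection (Submodule.span K (Set.range fun i => (b i).map (algebraMap k K)))) := by
  cases nonempty_fintype ι
  have hinf : (Set.range (algebraMap k K)).Infinite :=
    Set.infinite_range_of_injective (algebraMap k K).injective
  refine isDefinedOver_of_dense_rational (isZClosed_linearSection _)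
    (D := linearSection _ ∩ mk ''
      {M : GL (Fin n) K | ∃ M₀ : Matrix (Fin n) (Fin n) k, M.val = M₀.map (algebraMap k K)})
    Set.inter_subset_left ?_ fun h hh hD z hz => ?_
  · rintro h hh _ ⟨-, M, ⟨M₀, hM⟩, rfl⟩
    exact apply_mk_mem_range_of_val_eq_map hh hM
  · by_contra hne
    obtain ⟨s, M, hs, hM, hne, -⟩ := exists_coeff_mem_apply_ne_zero _ hinf
      (mem_regular_of_mem hh) (mem_regular_of_mem hh) ⟨z, hz, hne⟩ ⟨z, hz, hne⟩
    choose t ht using hs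
    refine hne (hD _ ⟨⟨M, (Submodule.mem_span_range_iff_exists_fun K).mpr ⟨s, hM.symm⟩, rfl⟩,
      M, ⟨∑ i, t i • b i, ?_⟩, rfl⟩)
    ext i j
    simp only [hM, ← ht, Matrix.sum_apply, Matrix.smul_apply, Matrix.map_apply, map_sum,
      smul_eq_mul, map_mul]

end LinearSection

section ProjectiveSpace

variable {k K : Type*} [Field k] [Field K] [Algebra k K] {n : ℕ}

theorem mk_smul_mk_eq_mk_iff {M : GL (Fin n) K} {v w : Fin n → K} (hv : v ≠ 0) (hw : w ≠ 0) :
    mk M • Projectivization.mk K v hv = Projectivization.mk K w hw ↔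
      ∃ c : K, M.val.mulVec v = c • w := by
  rw [Projectivization.PGL.mk_smul_mk, Projectivization.mk_eq_mk_iff']
  exact exists_congr fun c => eq_comm

theorem setOf_smul_eq_eq_linearSection (p q : ℙ K (Fin n → K)) :
    {g : PGL(n, K) | g • p = q} =
      linearSection ((K ∙ q.rep).comap ((Matrix.mulVecBilin K K).flip p.rep)) := by
  ext g
  obtain ⟨M, rfl⟩ := mk_surjective g
  rw [mk_mem_linearSection, Set.mem_ofPred_eq]
  nth_rw 1 [← p.mk_rep, ← q.mk_rep]
  simp only [mk_smul_mk_eq_mk_iff, Submodule.mem_comap, LinearMap.flip_apply,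
    Matrix.mulVecBilin_apply, Submodule.mem_span_singleton, eq_comm]

theorem isZClosed_setOf_smul_eq (p q : ℙ K (Fin n → K)) :
    IsZClosed (coordPGL k K n) {g : PGL(n, K) | g • p = q} :=
  setOf_smul_eq_eq_linearSection p q ▸ isZClosed_linearSection _

theorem isZConnected_stabilizer [Infinite K] (p : ℙ K (Fin n → K)) :
    IsZConnected (coordPGL k K n) (MulAction.stabilizer PGL(n, K) p : Set PGL(n, K)) := by
  have h : (MulAction.stabilizer PGL(n, K) p : Set PGL(n, K)) = linearSection _ :=
    setOf_smul_eq_eq_linearSection p p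
  exact h ▸ isZConnected_linearSection (h ▸ ⟨1, one_mem _⟩)

theorem isZConnected_univ [Infinite K] :
    IsZConnected (coordPGL k K n) (Set.univ : Set PGL(n, K)) :=
  have h := linearSection_top (K := K) (n := n)
  h ▸ isZConnected_linearSection (h ▸ ⟨1, trivial⟩)

theorem isPreprimitive_projectiveSpace :
    MulAction.IsPreprimitive PGL(n, K) (ℙ K (Fin n → K)) :=
  let f : ℙ K (Fin n → K) →ₑ[(Matrix.SpecialLinearGroup.toPGL :
      Matrix.SpecialLinearGroup (Fin n) K →* PGL(n, K))] ℙ K (Fin n → K) :=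
    { toFun := id
      map_smul' := fun _ p => p.ind fun _ _ => rfl }
  MulAction.IsPreprimitive.of_surjective (f := f) Function.surjective_id

theorem nontrivial_projectiveSpace {ι : Type*} [Nontrivial ι] : Nontrivial (ℙ K (ι → K)) := by
  classical
  obtain ⟨i, j, hij⟩ := exists_pair_ne ι
  refine ⟨.mk K (Pi.single i 1) (by simp), .mk K (Pi.single j 1) (by simp), ?_⟩
  rw [Ne, Projectivization.mk_eq_mk_iff']
  rintro ⟨c, hc⟩
  simpa [hij] using congrFun hc i

theorem isCoatom_stabilizer [Nontrivial (Fin n)] (p : ℙ K (Fin n → K)) :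
    IsCoatom (MulAction.stabilizer PGL(n, K) p) :=
  have := nontrivial_projectiveSpace (K := K) (ι := Fin n)
  have := isPreprimitive_projectiveSpace (K := K) (n := n)
  MulAction.IsPreprimitive.isCoatom_stabilizer_of_isPreprimitive _ p

theorem exists_smul_eq_self [IsAlgClosed K] [NeZero n] (g : PGL(n, K)) :
    ∃ p : ℙ K (Fin n → K), g • p = p := by
  obtain ⟨M, rfl⟩ := mk_surjective g
  obtain ⟨c, hc⟩ := Module.End.exists_eigenvalue (Matrix.toLin' M.val)
  obtain ⟨v, hv⟩ := hc.exists_hasEigenvector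
  exact ⟨.mk K v hv.2, (mk_smul_mk_eq_mk_iff hv.2 hv.2).mpr ⟨c, by simpa using hv.apply_eq_smul⟩⟩

theorem eq_smul_one_of_mulVec_eq_smul {M : Matrix (Fin n) (Fin n) K} {v : Fin n → Fin n → K}
    (hv : LinearIndependent K v) {c : K} (h : ∀ i, M.mulVec (v i) = c • v i) : M = c • 1 := by
  cases n with
  | zero => exact Subsingleton.elim _ _
  | succ n =>
    let b := basisOfLinearIndependentOfCardEqFinrank hv (by simp)
    apply Matrix.toLin'.injective
    exact b.ext fun i => by simpa [b] using h i

end ProjectiveSpace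

section ProjectiveLine

variable {k K : Type*} [Field k] [Field K] [Algebra k K]

theorem mk_eq_mk_of_mulVec_eq_smul {M : GL (Fin 2) K} (hM : mk M ≠ 1) {v w : Fin 2 → K}
    (hv : v ≠ 0) (hw : w ≠ 0) {c : K} (hMv : M.val.mulVec v = c • v)
    (hMw : M.val.mulVec w = c • w) : Projectivization.mk K v hv = Projectivization.mk K w hw := by
  by_contra hne
  have hvw : LinearIndependent K ![w, v] := (LinearIndependent.pair_iff' hw).mpr fun a ha =>
    hne ((Projectivization.mk_eq_mk_iff' K v w hv hw).mpr ⟨a, ha⟩)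
  refine hM (mk_eq_one_of_val_eq_smul_one (eq_smul_one_of_mulVec_eq_smul (c := c) hvw fun i => ?_))
  fin_cases i
  exacts [hMw, hMv]

theorem finite_setOf_smul_eq_self {g : PGL(2, K)} (hg : g ≠ 1) :
    {p : ℙ K (Fin 2 → K) | g • p = p}.Finite := by
  obtain ⟨M, rfl⟩ := mk_surjective g
  have hfix (p : ℙ K (Fin 2 → K)) (hp : mk M • p = p) : ∃ c : K, M.val.mulVec p.rep = c • p.rep :=
    (mk_smul_mk_eq_mk_iff p.rep_nonzero p.rep_nonzero).mp (by rwa [p.mk_rep])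
  choose! c hc using hfix
  have heigen : Set.MapsTo c {p | mk M • p = p}
      {a | Module.End.HasEigenvalue (Matrix.toLin' M.val) a} :=
    fun p hp => Module.End.hasEigenvalue_of_hasEigenvector
      ⟨Module.End.mem_eigenspace_iff.mpr (by simpa using hc p hp), p.rep_nonzero⟩
  refine Set.Finite.of_injOn heigen (fun p hp q hq hpq => ?_) (Module.End.finite_hasEigenvalue _)
  rw [← p.mk_rep, ← q.mk_rep]
  exact mk_eq_mk_of_mulVec_eq_smul hg p.rep_nonzero q.rep_nonzero (hc p hp) (hpq ▸ hc q hq)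

theorem isSolvable_of_apply_one_zero_eq_zero {R : Type*} [CommRing R]
    {B : Subgroup (GL (Fin 2) R)} (hB : ∀ M ∈ B, M.val 1 0 = 0) : Group.IsSolvable B := by
  let χ : B →* R × R :=
    { toFun := fun M => (M.1.val 0 0, M.1.val 1 1)
      map_one' := by simp
      map_mul' := fun M N => by
        simp [Matrix.mul_apply, Fin.sum_univ_two, hB M M.2, hB N N.2] }
  have hker (M : B) (hM : M ∈ χ.toHomUnits.ker) : M.1.val 0 0 = 1 ∧ M.1.val 1 1 = 1 :=
    Prod.ext_iff.mp (congrArg Units.val (MonoidHom.mem_ker.mp hM))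
  have hcomm (M N : χ.toHomUnits.ker) : M * N = N * M := by
    ext i j
    fin_cases i <;> fin_cases j <;>
      simp [Matrix.mul_apply, Fin.sum_univ_two, hker M.1 M.2, hker N.1 N.2, hB M.1 M.1.2,
        hB N.1 N.1.2, add_comm]
  have := Group.isSolvable_of_comm hcomm
  exact Group.isSolvable_of_ker_le_range χ.toHomUnits.ker.subtype χ.toHomUnits (by simp)

theorem isSolvable_stabilizer (p : ℙ K (Fin 2 → K)) :
    Group.IsSolvable (MulAction.stabilizer PGL(2, K) p) := by
  let e : ℙ K (Fin 2 → K) := Projectivization.mk K ![1, 0] (by simp)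
  have := isPreprimitive_projectiveSpace (K := K) (n := 2)
  obtain ⟨g, hg⟩ := MulAction.exists_smul_eq PGL(2, K) p e
  have htriangular (M : GL (Fin 2) K) (hM : M ∈ (MulAction.stabilizer PGL(2, K) e).comap mk) :
      M.val 1 0 = 0 := by
    obtain ⟨c, hc⟩ := (mk_smul_mk_eq_mk_iff _ _).mp (MulAction.mem_stabilizer_iff.mp hM)
    simpa [Matrix.mulVec, dotProduct] using congrFun hc 1
  have := isSolvable_of_apply_one_zero_eq_zero htriangular
  have := Group.isSolvable_of_surjective
    (mk.subgroupComap_surjective_of_surjective (MulAction.stabilizer PGL(2, K) e) mk_surjective)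
  exact Group.isSolvable_of_isSolvable_injective
    (f := (MulAction.stabilizerEquivStabilizer hg.symm).toMonoidHom)
    (MulAction.stabilizerEquivStabilizer hg.symm).injective

theorem mk_mul_self_of_trace_eq_zero {M : GL (Fin 2) K} (h : M.val.trace = 0) :
    mk M * mk M = 1 := by
  rw [← map_mul]
  refine mk_eq_one_of_val_eq_smul_one (c := -M.val.det) ?_
  have h11 : M.val 1 1 = -M.val 0 0 := by linear_combination M.val.trace_fin_two.symm.trans h
  ext i j
  fin_cases i <;> fin_cases j <;>
    simp [Matrix.mul_apply, Fin.sum_univ_two, Matrix.det_fin_two, h11] <;> ring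

end ProjectiveLine

section CharTwo

variable {k K : Type*} [Field k] [Field K] [Algebra k K] [CharP K 2]

theorem commute_of_commute_mk {M N : GL (Fin 2) K} (h : Commute (mk M) (mk N)) :
    Commute M N := by
  obtain ⟨c, -, hc⟩ := mk_eq_mk_iff_exists_smul.mp (show mk (M * N) = mk (N * M) from h)
  have hdet : c ^ 2 = 1 := by
    refine mul_right_cancel₀ (M * N).det_ne_zero ?_
    simpa [Matrix.det_smul, mul_comm, mul_assoc] using (congrArg Matrix.det hc).symm
  rw [← one_pow 2, CharTwo.sq_inj] at hdet
  exact Units.ext (by rw [hc, hdet, one_smul])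

theorem smul_eq_self_of_commute {d e : PGL(2, K)} (hd : d ≠ 1) (h : Commute d e)
    {p : ℙ K (Fin 2 → K)} (hp : d • p = p) : e • p = p := by
  obtain ⟨M, rfl⟩ := mk_surjective d
  obtain ⟨N, rfl⟩ := mk_surjective e
  induction p using Projectivization.ind with | _ v hv
  obtain ⟨c, hc⟩ := (mk_smul_mk_eq_mk_iff hv hv).mp hp
  refine mk_eq_mk_of_mulVec_eq_smul hd _ hv ?_ hc
  change M.val.mulVec (N.val.mulVec v) = c • N.val.mulVec v
  rw [Matrix.mulVec_mulVec, ← Units.val_mul, (commute_of_commute_mk h).eq, Units.val_mul,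
    ← Matrix.mulVec_mulVec, hc, Matrix.mulVec_smul]

-- `d` fixes the whole orbit of a fixed point `p` under `S`; since `d` has finitely many fixed
-- points, connectedness of `S` forces this orbit to be `{p}`.
theorem exists_le_stabilizer_of_commute_conj [IsAlgClosed K] {S : Subgroup PGL(2, K)}
    (hS : IsZConnected (coordPGL k K 2) (S : Set PGL(2, K))) {d : PGL(2, K)} (hd : d ≠ 1)
    (hcomm : ∀ s ∈ S, Commute (s⁻¹ * d * s) d) :
    ∃ p : ℙ K (Fin 2 → K), S ≤ MulAction.stabilizer PGL(2, K) p := by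
  obtain ⟨p, hp⟩ := exists_smul_eq_self d
  have horbit (s) (hs : s ∈ S) : d • s • p = s • p := by
    have h := smul_eq_self_of_commute hd (hcomm s hs).symm hp
    rwa [mul_smul, mul_smul, inv_smul_eq_iff] at h
  refine ⟨p, hS.subset_of_finite_cover (finite_setOf_smul_eq_self hd)
    (Z := fun q => {s | s • p = q}) (isZClosed_setOf_smul_eq p) ?_ ?_
    ⟨1, one_mem S, one_smul _ p⟩⟩
  · exact fun q r hqr => Set.disjoint_left.mpr fun s hq hr => hqr (hq.symm.trans hr)
  · exact fun s hs => Set.mem_biUnion (horbit s hs) rfl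

theorem exists_le_stabilizer_of_isSolvable [IsAlgClosed K] {S : Subgroup PGL(2, K)}
    (hS : IsZConnected (coordPGL k K 2) (S : Set PGL(2, K))) [Group.IsSolvable S] :
    ∃ p : ℙ K (Fin 2 → K), S ≤ MulAction.stabilizer PGL(2, K) p := by
  rcases S.bot_or_nontrivial with rfl | _
  · obtain ⟨p, -⟩ := exists_smul_eq_self (1 : PGL(2, K))
    exact ⟨p, bot_le⟩
  obtain ⟨d, hd, hcomm⟩ := exists_ne_one_forall_commute_conj S
  exact exists_le_stabilizer_of_commute_conj hS (d := d) (by simpa using hd)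
    fun s hs => (hcomm ⟨s, hs⟩).map S.subtype

theorem IsBorel.exists_eq_stabilizer [IsAlgClosed K] {B : Subgroup PGL(2, K)}
    (hB : IsBorel (coordPGL k K 2) B) :
    ∃ p : ℙ K (Fin 2 → K), B = MulAction.stabilizer PGL(2, K) p := by
  have := hB.prop.2.2
  have : Infinite K := IsAlgClosed.instInfinite
  obtain ⟨p, hp⟩ := exists_le_stabilizer_of_isSolvable hB.prop.2.1
  exact ⟨p, hB.eq_of_le
    ⟨isZClosed_setOf_smul_eq p p, isZConnected_stabilizer p, isSolvable_stabilizer p⟩ hp⟩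

theorem IsParabolic.eq_top_or_exists_eq_stabilizer [IsAlgClosed K] {P : Subgroup PGL(2, K)}
    (hP : IsParabolic (coordPGL k K 2) P) :
    P = ⊤ ∨ ∃ p : ℙ K (Fin 2 → K), P = MulAction.stabilizer PGL(2, K) p := by
  obtain ⟨-, B, hB, hle⟩ := hP
  obtain ⟨p, rfl⟩ := hB.exists_eq_stabilizer
  exact ((isCoatom_stabilizer p).le_iff.mp hle).imp_right fun h => ⟨p, h⟩

theorem trace_pow_two_pow {R : Type*} [CommRing R] [CharP R 2] (M : Matrix (Fin 2) (Fin 2) R)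
    (m : ℕ) : (M ^ 2 ^ m).trace = M.trace ^ 2 ^ m := by
  induction m with
  | zero => simp
  | succ m ih =>
    rw [pow_succ 2 m, pow_mul, pow_mul, ← ih]
    generalize M ^ 2 ^ m = N
    simp only [sq, Matrix.trace_fin_two, Matrix.mul_apply, Fin.sum_univ_two]
    linear_combination (N 0 1 * N 1 0 - N 0 0 * N 1 1) * CharTwo.two_eq_zero (R := R)

theorem IsUnipotentElement.mul_self_eq_one {g : PGL(2, K)}
    (hg : IsUnipotentElement (coordPGL k K 2) g) : g * g = 1 := by
  obtain ⟨m, hm⟩ := hg.exists_pow_char_pow_eq_one 2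
  obtain ⟨M, rfl⟩ := mk_surjective g
  rw [← map_pow, ← map_one mk, eq_comm, mk_eq_mk_iff_exists_smul] at hm
  obtain ⟨c, -, hc⟩ := hm
  have htrace : M.val.trace ^ 2 ^ m = 0 := by
    rw [← trace_pow_two_pow, ← Units.val_pow_eq_pow_val, hc]
    simp [CharTwo.two_eq_zero]
  exact mk_mul_self_of_trace_eq_zero (eq_zero_of_pow_eq_zero htrace)

theorem IsUnipotentSubgroup.eq_bot_of_normal [IsAlgClosed K] {N : Subgroup PGL(2, K)}
    (hN : IsUnipotentSubgroup (coordPGL k K 2) N) (hnormal : N.Normal) : N = ⊥ := by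
  have : Infinite K := IsAlgClosed.instInfinite
  by_contra hbot
  obtain ⟨⟨d, hd⟩, hd1⟩ := Subgroup.ne_bot_iff_exists_ne_one.mp hbot
  have hcomm (x y : N) : Commute x y := Commute.of_orderOf_dvd_two (fun z =>
    orderOf_dvd_of_pow_eq_one (by
      rw [sq]; exact Subtype.ext (hN z z.2).mul_self_eq_one)) x y
  have hS : IsZConnected (coordPGL k K 2) ((⊤ : Subgroup PGL(2, K)) : Set PGL(2, K)) :=
    isZConnected_univ
  obtain ⟨p, hp⟩ := exists_le_stabilizer_of_commute_conj hS (by simpa using hd1) fun s _ =>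
    (hcomm ⟨s⁻¹ * d * s, by simpa using hnormal.conj_mem d hd s⁻¹⟩ ⟨d, hd⟩).map
      N.subtype
  exact (isCoatom_stabilizer p).1 (top_le_iff.mp hp)

variable (k K) in
theorem unipotentRadical_top [IsAlgClosed K] :
    unipotentRadical (coordPGL k K 2) (⊤ : Subgroup PGL(2, K)) = ⊥ := by
  refine sSup_eq_bot.mpr ?_
  rintro N ⟨-, hnorm, -, -, hun⟩
  have hnormal := Subgroup.normalizer_eq_top_iff.mp
    (top_le_iff.mp ((Subgroup.normal_subgroupOf_iff_le_normalizer le_top).mp hnorm))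
  exact (isUnipotentSubgroup_regular.mp hun).eq_bot_of_normal hnormal

end CharTwo

section PolynomialCurve

open Polynomial

variable {k K : Type*} [Field k] [Field K] [Algebra k K] {n : ℕ}

theorem IsDefinedOver.exists_minpoly_dvd {Z : Set PGL(n, K)} (hZ : IsDefinedOver (coordPGL k K n) Z)
    {φ : Matrix (Fin n) (Fin n) k[X]} {z₀ : K} {M₀ : GL (Fin n) K}
    (hM₀ : M₀.val = φ.map (aeval z₀)) (hM₀Z : mk M₀ ∈ Z) {f : PGL(n, K) → K}
    (hf : f ∈ regular (coordPGL k K n)) (hfZ : ∀ z ∈ Z, f z = 0) :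
    ∃ (N : ℕ) (r : K[X]), (minpoly k z₀).map (algebraMap k K) ∣ r ∧
      ∀ (z : K) (M : GL (Fin n) K), M.val = φ.map (aeval z) →
        f (mk M) * M.val.det ^ N = r.eval z := by
  have hdet (z : K) (M : GL (Fin n) K) (hM : M.val = φ.map (aeval z)) :
      M.val.det = (φ.det.map (algebraMap k K)).eval z := by
    rw [eval_map_algebraMap, AlgHom.map_det, hM]
    rfl
  have hspan := hZ.2 f hf hfZ
  clear hf hfZ
  induction hspan using Submodule.span_induction with
  | mem h hh =>
    obtain ⟨N, r, hr⟩ := exists_eval_eq_of_mem_coordPGL φ hh.1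
    have hroot : aeval z₀ r = 0 := by rw [← hr (aeval z₀) M₀ hM₀, hh.2 _ hM₀Z, zero_mul]
    refine ⟨N, r.map (algebraMap k K), Polynomial.map_dvd _ (minpoly.dvd k z₀ hroot),
      fun z M hM => ?_⟩
    rw [eval_map_algebraMap, hr (aeval z) M hM]
  | zero => exact ⟨0, 0, dvd_zero _, by simp⟩
  | add f f' _ _ h h' =>
    obtain ⟨N, r, hdvd, hr⟩ := h
    obtain ⟨N', r', hdvd', hr'⟩ := h'
    refine ⟨N + N', r * φ.det.map (algebraMap k K) ^ N' + r' * φ.det.map (algebraMap k K) ^ N,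
      dvd_add (hdvd.mul_right _) (hdvd'.mul_right _), fun z M hM => ?_⟩
    simp only [eval_add, eval_mul, eval_pow, ← hr z M hM, ← hr' z M hM, ← hdet z M hM, Pi.add_apply]
    ring
  | smul c f _ h =>
    obtain ⟨N, r, hdvd, hr⟩ := h
    refine ⟨N, C c * r, hdvd.mul_left _, fun z M hM => ?_⟩
    rw [eval_mul, eval_C, ← hr z M hM, Pi.smul_apply, smul_eq_mul, mul_assoc]

theorem exists_mem_regular_vanishing_on_stabilizer (α : K) :
    ∃ f ∈ regular (coordPGL k K 2),
      (∀ g ∈ MulAction.stabilizer PGL(2, K) (Projectivization.mk K ![α, 1] (by simp)), f g = 0) ∧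
      ∀ M : GL (Fin 2) K, f (mk M) =
        (M.val.mulVec ![α, 1] 0 - α * M.val.mulVec ![α, 1] 1) * M.val 0 0 * M.val.det⁻¹ := by
  let ℓ : Matrix (Fin 2) (Fin 2) K →ₗ[K] K :=
    (LinearMap.proj 0 - α • LinearMap.proj 1) ∘ₗ (Matrix.mulVecBilin K K).flip ![α, 1]
  obtain ⟨f, hf, hfℓ⟩ := exists_mem_regular_linear_mul_pow (k := k) ℓ 0 0
  refine ⟨f, hf, fun g hg => ?_, fun M => by simp [hfℓ, ℓ]⟩
  obtain ⟨M, rfl⟩ := mk_surjective g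
  obtain ⟨c, hc⟩ := (mk_smul_mk_eq_mk_iff _ _).mp hg
  simp [hfℓ, ℓ, hc, mul_comm]

-- For `t ∈ k \ {0, 1}`, the matrix `!![1, (t - 1) * z; 0, t]` fixes `[α : 1]` only if `z = α`, and
-- the equation of the stabilizer restricts to a polynomial of degree one along this line. Were the
-- stabilizer defined over `k`, the minimal polynomial of `α` would divide it.
theorem not_isDefinedOver_stabilizer [Infinite k] {α : K} (hint : IsIntegral k α)
    (hα : α ∉ (algebraMap k K).range) :
    ¬ IsDefinedOver (coordPGL k K 2) (MulAction.stabilizer PGL(2, K)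
      (Projectivization.mk K ![α, 1] (by simp)) : Set PGL(2, K)) := by
  classical
  intro hdef
  have : Infinite K := Infinite.of_injective _ (algebraMap k K).injective
  obtain ⟨t, ht⟩ := Infinite.exists_notMem_finset ({0, 1} : Finset k)
  obtain ⟨ht0, ht1⟩ : algebraMap k K t ≠ 0 ∧ algebraMap k K t ≠ 1 := by simpa using ht
  let φ : Matrix (Fin 2) (Fin 2) k[X] := !![1, C (t - 1) * X; 0, C t]
  let M (z : K) : GL (Fin 2) K := Matrix.GeneralLinearGroup.mkOfDetNeZero
    !![1, (algebraMap k K t - 1) * z; 0, algebraMap k K t] (by simpa using ht0)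
  have hM (z : K) : (M z).val = φ.map (aeval z) := by
    ext i j
    fin_cases i <;> fin_cases j <;> simp [M, φ, Matrix.GeneralLinearGroup.mkOfDetNeZero]
  obtain ⟨f, hf, hfZ, hfM⟩ := exists_mem_regular_vanishing_on_stabilizer (k := k) α
  have hMv (z : K) :
      (M z).val.mulVec ![α, 1] = ![α + (algebraMap k K t - 1) * z, algebraMap k K t] := by
    ext i
    fin_cases i <;> simp [M]
  have hMα : mk (M α) ∈ MulAction.stabilizer PGL(2, K)
      (Projectivization.mk K ![α, 1] (by simp)) := by
    refine (mk_smul_mk_eq_mk_iff _ _).mpr ⟨algebraMap k K t, ?_⟩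
    rw [hMv, Matrix.smul_vec2, smul_eq_mul, smul_eq_mul, mul_one, sub_one_mul,
      add_sub_cancel]
  obtain ⟨N, r, hdvd, hr⟩ := hdef.exists_minpoly_dvd (hM α) hMα hf hfZ
  let c := (algebraMap k K t - 1) * (algebraMap k K t)⁻¹ * algebraMap k K t ^ N
  have hc : c ≠ 0 :=
    mul_ne_zero (mul_ne_zero (sub_ne_zero.mpr ht1) (inv_ne_zero ht0)) (pow_ne_zero _ ht0)
  have hrc : r = C c * (X - C α) := by
    refine Polynomial.funext fun z => ?_
    rw [← hr z (M z) (hM z), hfM, hMv, show (M z).val.det = algebraMap k K t by simp [M],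
      show (M z).val 0 0 = 1 from rfl]
    simp only [Matrix.cons_val_zero, Matrix.cons_val_one, eval_mul, eval_sub, eval_C, eval_X, c]
    ring
  have hle := natDegree_le_of_dvd hdvd (hrc ▸ mul_ne_zero (C_ne_zero.mpr hc) (X_sub_C_ne_zero α))
  rw [natDegree_map, hrc, natDegree_C_mul hc, natDegree_X_sub_C] at hle
  exact absurd ((minpoly.two_le_natDegree_iff hint).mpr hα) (by lia)

end PolynomialCurve

section QuadraticSubgroup

variable {k K : Type*} [Field k] [Field K] [Algebra k K]

theorem mem_span_one_antidiag_iff {b : K} {M : Matrix (Fin 2) (Fin 2) K} :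
    M ∈ Submodule.span K {1, !![0, b; 1, 0]} ↔ ∃ x y, M = !![x, b * y; y, x] := by
  rw [Submodule.mem_span_pair]
  refine exists_congr fun x => exists_congr fun y => ?_
  rw [eq_comm, Matrix.one_fin_two]
  simp [mul_comm]

/-- The image in `PGL₂(K)` of the unit group of the quadratic algebra `K[T] / (T² - b)`, embedded in
`M₂(K)` by its regular representation; its elements are the classes of `!![x, b * y; y, x]`. -/
def quadraticSubgroup (b : K) : Subgroup PGL(2, K) where
  carrier := linearSection (Submodule.span K {1, !![0, b; 1, 0]})
  one_mem' := ⟨1, Submodule.subset_span (Set.mem_insert _ _), map_one mk⟩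
  mul_mem' := by
    rintro _ _ ⟨M, hM, rfl⟩ ⟨N, hN, rfl⟩
    obtain ⟨x, y, hM⟩ := mem_span_one_antidiag_iff.mp hM
    obtain ⟨x', y', hN⟩ := mem_span_one_antidiag_iff.mp hN
    refine ⟨M * N, mem_span_one_antidiag_iff.mpr ⟨x * x' + b * y * y', y * x' + x * y', ?_⟩,
      map_mul mk M N⟩
    ext i j
    fin_cases i <;> fin_cases j <;> simp [hM, hN] <;> ring
  inv_mem' := by
    rintro _ ⟨M, hM, rfl⟩
    obtain ⟨x, y, hM⟩ := mem_span_one_antidiag_iff.mp hM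
    refine ⟨M⁻¹, mem_span_one_antidiag_iff.mpr ⟨M.val.det⁻¹ * x, -(M.val.det⁻¹ * y), ?_⟩,
      map_inv mk M⟩
    rw [Matrix.coe_units_inv, Matrix.inv_def, Ring.inverse_eq_inv', hM, Matrix.adjugate_fin_two]
    simp [mul_left_comm]

theorem coe_quadraticSubgroup (b : K) :
    (quadraticSubgroup b : Set PGL(2, K)) = {h | ∃ (M : GL (Fin 2) K) (x y : K),
      (M : Matrix (Fin 2) (Fin 2) K) = !![x, b * y; y, x] ∧ mk M = h} := by
  ext g
  constructor
  · rintro ⟨M, hM, rfl⟩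
    obtain ⟨x, y, h⟩ := mem_span_one_antidiag_iff.mp hM
    exact ⟨M, x, y, h, rfl⟩
  · rintro ⟨M, x, y, h, rfl⟩
    exact ⟨M, mem_span_one_antidiag_iff.mpr ⟨x, y, h⟩, rfl⟩

theorem isDefinedOver_quadraticSubgroup [Infinite k] (a : k) :
    IsDefinedOver (coordPGL k K 2) (quadraticSubgroup (algebraMap k K a) : Set PGL(2, K)) := by
  have hrange : Set.range (fun i => (![1, !![0, a; 1, 0]] i).map (algebraMap k K)) =
      {1, !![0, algebraMap k K a; 1, 0]} := by
    have hmap : !![0, a; 1, 0].map (algebraMap k K) = !![0, algebraMap k K a; 1, 0] := by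
      ext i j
      fin_cases i <;> fin_cases j <;> simp
    ext M
    simp [Fin.exists_fin_two, hmap, eq_comm]
  have hdef := isDefinedOver_linearSection (K := K) ![1, !![0, a; 1, 0]]
  rwa [hrange] at hdef

theorem isZConnected_quadraticSubgroup [Infinite K] (b : K) :
    IsZConnected (coordPGL k K 2) (quadraticSubgroup b : Set PGL(2, K)) :=
  isZConnected_linearSection ⟨1, one_mem (quadraticSubgroup b)⟩

theorem isUnipotentSubgroup_quadraticSubgroup [CharP K 2] (b : K) :
    IsUnipotentSubgroup (coordPGL k K 2) (quadraticSubgroup b) := by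
  rintro _ ⟨M, hM, rfl⟩
  obtain ⟨x, y, hM⟩ := mem_span_one_antidiag_iff.mp hM
  refine isUnipotentElement_of_pow_char_pow_eq_one 2 (m := 1) ?_
  rw [pow_one, sq, mk_mul_self_of_trace_eq_zero]
  simp [hM, Matrix.trace_fin_two, CharTwo.add_self_eq_zero]

theorem exists_mk_mem_quadraticSubgroup {b : K} (hb : b ≠ 0) :
    ∃ T : GL (Fin 2) K, T.val = !![0, b; 1, 0] ∧ mk T ∈ quadraticSubgroup b ∧ mk T ≠ 1 := by
  let T := Matrix.GeneralLinearGroup.mkOfDetNeZero !![0, b; 1, 0] (by simpa using hb)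
  refine ⟨T, rfl, ⟨T, mem_span_one_antidiag_iff.mpr ⟨0, 1, by simp [T]⟩, rfl⟩, fun h => ?_⟩
  rw [← map_one mk, eq_comm, mk_eq_mk_iff_exists_smul] at h
  obtain ⟨c, -, hc⟩ := h
  simpa [T, Matrix.GeneralLinearGroup.mkOfDetNeZero] using congrFun (congrFun hc 1) 0

theorem quadraticSubgroup_ne_bot {b : K} (hb : b ≠ 0) : quadraticSubgroup b ≠ ⊥ := by
  obtain ⟨T, -, hmem, hne⟩ := exists_mk_mem_quadraticSubgroup hb
  exact Subgroup.ne_bot_iff_exists_ne_one.mpr ⟨⟨_, hmem⟩, fun h => hne (congrArg Subtype.val h)⟩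

theorem eq_of_quadraticSubgroup_le_stabilizer [CharP K 2] {α : K} (hα : α ≠ 0)
    {p : ℙ K (Fin 2 → K)} (hp : quadraticSubgroup (α ^ 2) ≤ MulAction.stabilizer PGL(2, K) p) :
    p = Projectivization.mk K ![α, 1] (by simp) := by
  obtain ⟨T, hT, hmem, hne⟩ := exists_mk_mem_quadraticSubgroup (pow_ne_zero 2 hα)
  induction p using Projectivization.ind with | _ v hv
  obtain ⟨c, hc⟩ := (mk_smul_mk_eq_mk_iff hv hv).mp (hp hmem)
  have hsq : c ^ 2 • v = α ^ 2 • v := by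
    calc c ^ 2 • v = T.val.mulVec (T.val.mulVec v) := by
          rw [hc, Matrix.mulVec_smul, hc, smul_smul, sq]
      _ = (α ^ 2 • (1 : Matrix (Fin 2) (Fin 2) K)).mulVec v := by
          rw [Matrix.mulVec_mulVec, hT, Matrix.one_fin_two]
          simp
      _ = α ^ 2 • v := by rw [Matrix.smul_mulVec, Matrix.one_mulVec]
  have hcα : c = α := CharTwo.sq_inj.mp (smul_left_injective K hv hsq)
  refine mk_eq_mk_of_mulVec_eq_smul hne hv _ hc ?_
  rw [hT, hcα]
  ext i
  fin_cases i <;> simp [sq]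

theorem infinite_of_not_isSquare [CharP k 2] {a : k} (ha : ¬ IsSquare a) : Infinite k := by
  by_contra h
  have := not_infinite_iff_finite.mp h
  exact ha (FiniteField.isSquare_of_char_two (F := k) (ringChar.eq k 2) a)

theorem exists_not_isSquare_of_not_perfectField [CharP k 2] (hk : ¬ PerfectField k) :
    ∃ a : k, ¬ IsSquare a := by
  by_contra! h
  have : PerfectRing k 2 := PerfectRing.ofSurjective k 2 fun a =>
    (h a).imp fun b hb => by rw [frobenius_def, sq, hb]
  exact hk (PerfectRing.toPerfectField k 2)

theorem isIrreducibleOver_quadraticSubgroup [CharP K 2] [IsAlgClosed K] [Infinite k] {a : k}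
    (ha : ¬ IsSquare a) :
    IsIrreducibleOver (coordPGL k K 2) (quadraticSubgroup (algebraMap k K a)) := by
  rintro P ⟨hP, hdef⟩ hle
  refine hP.eq_top_or_exists_eq_stabilizer.resolve_right ?_
  rintro ⟨p, rfl⟩
  obtain ⟨α, hα⟩ := IsAlgClosed.exists_pow_nat_eq (algebraMap k K a) two_pos
  have hαk : α ∉ (algebraMap k K).range := by
    rintro ⟨c, rfl⟩
    exact ha ⟨c, (algebraMap k K).injective (by rw [← hα, map_mul, sq])⟩
  have hα0 : α ≠ 0 := fun h => hαk (h ▸ zero_mem _)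
  have hint : IsIntegral k α := .of_pow two_pos (hα ▸ isIntegral_algebraMap)
  rw [← hα] at hle
  rw [eq_of_quadraticSubgroup_le_stabilizer hα0 hle] at hdef
  exact not_isDefinedOver_stabilizer hint hαk hdef

end QuadraticSubgroup

end AlgGrp

theorem mainTheorem7_general (k K : Type*) [Field k] [CharP k 2] (hk : ¬ PerfectField k)
    [Field K] [Algebra k K] [IsAlgClosed K] :
    (∃ a : k, ¬ IsSquare a) ∧
    ∀ a : k, ¬ IsSquare a →
      ∃ H : Subgroup PGL(2, K),
        (H : Set PGL(2, K)) =
          {h | ∃ (M : GL (Fin 2) K) (x y : K),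
            (M : Matrix (Fin 2) (Fin 2) K) = !![x, algebraMap k K a * y; y, x] ∧
              Matrix.ProjGenLinGroup.mk M = h} ∧
        AlgGrp.IsDefinedOver (AlgGrp.coordPGL k K 2) (H : Set PGL(2, K)) ∧
        AlgGrp.IsZConnected (AlgGrp.coordPGL k K 2) (H : Set PGL(2, K)) ∧
        AlgGrp.IsUnipotentSubgroup (AlgGrp.coordPGL k K 2) H ∧
        AlgGrp.IsIrreducibleOver (AlgGrp.coordPGL k K 2) H ∧
        AlgGrp.IsCompletelyReducibleOver (AlgGrp.coordPGL k K 2) H ∧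
        ¬ AlgGrp.IsPseudoReductive (AlgGrp.coordPGL k K 2) H := by
  have : CharP K 2 := charP_of_injective_algebraMap (algebraMap k K).injective 2
  refine ⟨AlgGrp.exists_not_isSquare_of_not_perfectField hk, fun a ha => ?_⟩
  have : Infinite k := AlgGrp.infinite_of_not_isSquare ha
  have : Infinite K := IsAlgClosed.instInfinite
  have ha0 : algebraMap k K a ≠ 0 := fun h =>
    ha ((map_eq_zero (algebraMap k K)).mp h ▸ IsSquare.zero)
  have hun := AlgGrp.isUnipotentSubgroup_quadraticSubgroup (k := k) (algebraMap k K a)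
  have hirr := AlgGrp.isIrreducibleOver_quadraticSubgroup (K := K) ha
  exact ⟨AlgGrp.quadraticSubgroup (algebraMap k K a), AlgGrp.coe_quadraticSubgroup _,
    AlgGrp.isDefinedOver_quadraticSubgroup a, AlgGrp.isZConnected_quadraticSubgroup _, hun, hirr,
    hirr.isCompletelyReducibleOver (AlgGrp.unipotentRadical_top k K),
    AlgGrp.not_isPseudoReductive_of_isUnipotentSubgroup (AlgGrp.quadraticSubgroup_ne_bot ha0) hun⟩

theorem mainTheorem7 (k K : Type*) [Field k] [CharP k 2] (hk : ¬ PerfectField k)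
    [Field K] [Algebra k K] [IsAlgClosure k K] :
    (∃ a : k, ¬ IsSquare a) ∧
    ∀ a : k, ¬ IsSquare a →
      ∃ H : Subgroup PGL(2, K),
        (H : Set PGL(2, K)) =
          {h | ∃ (M : GL (Fin 2) K) (x y : K),
            (M : Matrix (Fin 2) (Fin 2) K) = !![x, algebraMap k K a * y; y, x] ∧
              Matrix.ProjGenLinGroup.mk M = h} ∧
        AlgGrp.IsDefinedOver (AlgGrp.coordPGL k K 2) (H : Set PGL(2, K)) ∧
        AlgGrp.IsZConnected (AlgGrp.coordPGL k K 2) (H : Set PGL(2, K)) ∧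
        AlgGrp.IsUnipotentSubgroup (AlgGrp.coordPGL k K 2) H ∧
        AlgGrp.IsIrreducibleOver (AlgGrp.coordPGL k K 2) H ∧
        AlgGrp.IsCompletelyReducibleOver (AlgGrp.coordPGL k K 2) H ∧
        ¬ AlgGrp.IsPseudoReductive (AlgGrp.coordPGL k K 2) H := by
  have : IsAlgClosed K := IsAlgClosure.isAlgClosed k
  exact mainTheorem7_general k K hk
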